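/- Let $G$ be a finite simple graph. Write $\delta(G)$ for its minimum degree and $\alpha(G)$ for its independence number, i.e. the maximum size of a set of vertices no two of which are adjacent. If $\delta(G) \ge 300\,\alpha(G)$, then for every integer $\ell$ with $3 \le \ell \le \delta(G)/81$ the graph $G$ contains a cycle of length $\ell$ (that is, with exactly $\ell$ edges). -/

import Mathlib

namespace SimpleGraph

/-! ### Joining paths into cycles -/

variable {V : Type*} {G : SimpleGraph V}

/-! Take the distance levels from a vertex `v` and a tree of parents. A path with both ends in level
`i` that never goes below it closes up through the tree, adding `2 * (h + 1)` edges if the ancestor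
lines of its ends first meet after `h + 1` steps.

If a level of index below `l / 2` has more than `(l - 2) * α` vertices, it contains a long path
ordered consistently with the tree, and a window of this path closes to length exactly `l`
(`exists_isCycle_of_card_level`).

Otherwise the levels cannot keep doubling, so an early one grows slowly (`exists_slow_growth`). By
the minimum degree, edges are then dense inside it or towards a neighbouring level. There, chains of
triangles give paths of every length in an interval with fixed ends, wide enough to absorb the
unknown height (`exists_isCycle_of_dense_levels`). -/

lemma Walk.IsPath.exists_isCycle_of_disjoint {x y u w : V} {p : G.Walk x y} {r : G.Walk u w}
    (hp : p.IsPath) (hr : r.IsPath) (hd : ∀ z ∈ p.support, z ∉ r.support)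
    (hu : G.Adj x u) (hw : G.Adj y w) (hlen : 1 ≤ p.length) :
    ∃ (v : V) (c : G.Walk v v), c.IsCycle ∧ c.length = p.length + r.length + 2 := by
  refine ⟨u, Walk.cons hu.symm (p.append (Walk.cons hw r.reverse)), ?_, ?_⟩
  · rw [Walk.isCycle_iff_isPath_tail_and_le_length]
    constructor
    · rw [Walk.isPath_def, Walk.support_tail_of_not_nil _ Walk.not_nil_cons, Walk.support_cons,
        List.tail_cons, Walk.support_append, Walk.support_cons, List.tail_cons,
        Walk.support_reverse, List.nodup_append]
      refine ⟨hp.support_nodup, List.nodup_reverse.2 hr.support_nodup, ?_⟩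
      rintro a ha b hb rfl
      exact hd a ha (List.mem_reverse.1 hb)
    · simp only [Walk.length_cons, Walk.length_append, Walk.length_reverse]
      omega
  · simp only [Walk.length_cons, Walk.length_append, Walk.length_reverse]
    omega

lemma exists_isPath_of_injOn {x : ℕ → V} {M : ℕ} (hadj : ∀ a < M, G.Adj (x a) (x (a + 1)))
    (hinj : ∀ a ≤ M, ∀ b ≤ M, x a = x b → a = b) (a n : ℕ) (h : a + n ≤ M) :
    ∃ p : G.Walk (x a) (x (a + n)), p.IsPath ∧ p.length = n ∧
      ∀ z ∈ p.support, ∃ c, a ≤ c ∧ c ≤ a + n ∧ z = x c := by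
  induction n with
  | zero =>
    exact ⟨Walk.nil, Walk.IsPath.nil, rfl, fun z hz => ⟨a, le_rfl, le_rfl, by simpa using hz⟩⟩
  | succ n ih =>
    obtain ⟨p, hp, hl, hs⟩ := ih (by omega)
    refine ⟨p.concat (hadj (a + n) (by omega)), hp.concat (fun hz => ?_) _, by simp [hl], ?_⟩
    · obtain ⟨c, hc1, hc2, hc⟩ := hs _ hz
      have := hinj _ (by omega) _ (by omega) hc
      omega
    · intro z hz
      rw [Walk.support_concat, List.mem_append] at hz
      rcases hz with hz | hz
      · obtain ⟨c, hc1, hc2, hc⟩ := hs _ hz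
        exact ⟨c, hc1, by omega, hc⟩
      · exact ⟨a + (n + 1), by omega, by omega, by simpa using hz⟩

/-! ### Ancestors in the tree of distances -/

/-- `π` sends each vertex at distance `i + 1` from `v` to a neighbour at distance `i`. -/
def IsParentMap (G : SimpleGraph V) (v : V) (π : V → V) : Prop :=
  ∀ (x : V) (i : ℕ), G.edist v x = (i + 1 : ℕ) → G.Adj x (π x) ∧ G.edist v (π x) = i

lemma exists_isParentMap (v : V) : ∃ π, G.IsParentMap v π := by
  classical
  have key : ∀ x : V, ∃ y, ∀ i : ℕ, G.edist v x = (i + 1 : ℕ) →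
      G.Adj x y ∧ G.edist v y = i := by
    intro x
    by_cases h : ∃ i : ℕ, G.edist v x = (i + 1 : ℕ)
    · obtain ⟨i, hi⟩ := h
      obtain ⟨p, hp⟩ := exists_walk_of_edist_eq_coe (G.edist_comm.trans hi : G.edist x v = _)
      cases p with
      | nil => simp at hp
      | @cons _ y _ hxy q =>
        refine ⟨y, fun j hj => ?_⟩
        have hij : i = j := by
          rw [hi] at hj
          have := Nat.cast_injective (R := ℕ∞) hj
          omega
        subst hij
        refine ⟨hxy, le_antisymm ?_ ?_⟩
        · rw [edist_comm]
          refine (edist_le q).trans ?_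
          simp only [Walk.length_cons] at hp
          exact_mod_cast (by omega : q.length ≤ i)
        · have h1 : G.edist v x ≤ G.edist v y + G.edist y x := SimpleGraph.edist_triangle
          rw [edist_eq_one_iff_adj.2 hxy.symm, hi] at h1
          push_cast at h1
          exact (ENat.add_le_add_iff_right (by simp)).1 h1
    · exact ⟨x, fun i hi => (h ⟨i, hi⟩).elim⟩
  choose π hπ using key
  exact ⟨π, fun x i hi => hπ x i hi⟩

namespace IsParentMap

variable {v : V} {π : V → V}

lemma edist_iterate (hπ : G.IsParentMap v π) {x : V} (j t : ℕ)
    (hx : G.edist v x = (j + t : ℕ)) : G.edist v (π^[t] x) = j := by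
  induction t generalizing x with
  | zero => simpa using hx
  | succ t ih =>
    rw [Function.iterate_succ_apply]
    exact ih (hπ x (j + t) hx).2

/-- Two vertices of the same level whose lines of ancestors merge after exactly `h + 1` steps have
their parents joined by a path of length `2 * h` through lower levels. -/
lemma exists_isPath_parents (hπ : G.IsParentMap v π) (h : ℕ) {x y : V} {i : ℕ} (hi : h + 1 ≤ i)
    (hx : G.edist v x = i) (hy : G.edist v y = i)
    (heq : π^[h + 1] x = π^[h + 1] y) (hne : π^[h] x ≠ π^[h] y) :
    ∃ r : G.Walk (π x) (π y), r.IsPath ∧ r.length = 2 * h ∧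
      ∀ z ∈ r.support, G.edist v z < i := by
  induction h generalizing x y i with
  | zero =>
    obtain ⟨i, rfl⟩ : ∃ k, i = k + 1 := ⟨i - 1, by omega⟩
    have e : π x = π y := by simpa using heq
    refine ⟨Walk.nil.copy rfl e, by simp, by simp, ?_⟩
    intro z hz
    simp only [Walk.support_copy, Walk.support_nil, List.mem_singleton] at hz
    rw [hz, (hπ x i hx).2]
    exact_mod_cast Nat.lt_succ_self i
  | succ h ih =>
    obtain ⟨i, rfl⟩ : ∃ k, i = k + 1 := ⟨i - 1, by omega⟩
    have hx' := (hπ x i hx).2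
    have hy' := (hπ y i hy).2
    obtain ⟨r, hr, hl, hs⟩ := ih (x := π x) (y := π y) (i := i) (by omega) hx' hy'
      (by simpa only [Function.iterate_succ_apply] using heq)
      (by simpa only [Function.iterate_succ_apply] using hne)
    obtain ⟨k, rfl⟩ : ∃ k, i = k + 1 := ⟨i - 1, by omega⟩
    have ax := (hπ _ k hx').1
    have ay := (hπ _ k hy').1
    have hxy : π x ≠ π y := fun e => hne (by simp only [Function.iterate_succ_apply, e])
    refine ⟨Walk.cons ax (r.concat ay.symm), ?_, by simp [hl]; omega, ?_⟩
    · rw [Walk.cons_isPath_iff]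
      refine ⟨hr.concat (fun hz => ?_) _, fun hz => ?_⟩
      · exact (hs _ hz).ne hy'
      · rw [Walk.support_concat, List.mem_append] at hz
        rcases hz with hz | hz
        · exact (hs _ hz).ne hx'
        · exact hxy (by simpa using hz)
    · intro z hz
      have hlt : ((k + 1 : ℕ) : ℕ∞) < (k + 1 + 1 : ℕ) := by exact_mod_cast Nat.lt_succ_self _
      rw [Walk.support_cons, List.mem_cons, Walk.support_concat,
        List.mem_append, List.mem_singleton] at hz
      rcases hz with rfl | hz | rfl
      · rwa [hx']
      · exact (hs _ hz).trans hlt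
      · rwa [hy']

/-- A path between two vertices of level `i` that stays in levels `≥ i` closes up to a cycle through
the first common ancestor of its ends. -/
lemma exists_isCycle (hπ : G.IsParentMap v π) (h : ℕ) {x y : V} {i : ℕ} (hi : h + 1 ≤ i)
    (hx : G.edist v x = i) (hy : G.edist v y = i)
    (heq : π^[h + 1] x = π^[h + 1] y) (hne : π^[h] x ≠ π^[h] y)
    (p : G.Walk x y) (hp : p.IsPath) (hs : ∀ z ∈ p.support, (i : ℕ∞) ≤ G.edist v z) :
    ∃ (u : V) (c : G.Walk u u), c.IsCycle ∧ c.length = p.length + 2 * (h + 1) := by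
  obtain ⟨r, hr, hl, hrs⟩ := hπ.exists_isPath_parents h hi hx hy heq hne
  obtain ⟨i, rfl⟩ : ∃ k, i = k + 1 := ⟨i - 1, by omega⟩
  have hxy : x ≠ y := fun e => hne (by rw [e])
  obtain ⟨u, c, hc, hcl⟩ := hp.exists_isCycle_of_disjoint hr
    (fun z hz hz' => (hs z hz).not_gt (hrs z hz')) (hπ x i hx).1 (hπ y i hy).1
    (Nat.one_le_iff_ne_zero.2 fun h0 => hxy (Walk.eq_of_length_eq_zero h0))
  exact ⟨u, c, hc, by omega⟩

/-- Distinct vertices of level `i` have lines of ancestors merging after some number of steps. -/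
lemma exists_height (hπ : G.IsParentMap v π) {x y : V} {i : ℕ}
    (hx : G.edist v x = i) (hy : G.edist v y = i) (hxy : x ≠ y) :
    ∃ h, h + 1 ≤ i ∧ π^[h + 1] x = π^[h + 1] y ∧ π^[h] x ≠ π^[h] y := by
  classical
  have hex : ∃ h, π^[h] x = π^[h] y := by
    refine ⟨i, ?_⟩
    have h1 := hπ.edist_iterate 0 i (x := x) (by simpa using hx)
    have h2 := hπ.edist_iterate 0 i (x := y) (by simpa using hy)
    simp only [Nat.cast_zero, edist_eq_zero_iff] at h1 h2
    rw [← h1, ← h2]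
  have hle : Nat.find hex ≤ i := by
    refine Nat.find_min' hex ?_
    have h1 := hπ.edist_iterate 0 i (x := x) (by simpa using hx)
    have h2 := hπ.edist_iterate 0 i (x := y) (by simpa using hy)
    simp only [Nat.cast_zero, edist_eq_zero_iff] at h1 h2
    rw [← h1, ← h2]
  have hpos : Nat.find hex ≠ 0 := fun h0 => hxy (by simpa [h0] using Nat.find_spec hex)
  refine ⟨Nat.find hex - 1, by omega, ?_, Nat.find_min hex (by omega)⟩
  rw [Nat.sub_add_cancel (Nat.one_le_iff_ne_zero.2 hpos)]
  exact Nat.find_spec hex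

end IsParentMap

/-! ### Large levels -/

/-- Numbering of the vertices of level `j` that lists them in the lexicographic order of their lines
of ancestors. -/
def ancestorKey (π : V → V) (idx : V → ℕ) (n : ℕ) : ℕ → V → ℕ
  | 0, x => idx x
  | j + 1, x => ancestorKey π idx n j (π x) * n + idx x

lemma ancestorKey_injective {π : V → V} {idx : V → ℕ} {n : ℕ} (hidx : Function.Injective idx)
    (hn : ∀ x, idx x < n) (j : ℕ) : Function.Injective (ancestorKey π idx n j) := by
  cases j with
  | zero => exact hidx
  | succ j =>
    intro x y hxy
    have := congrArg (· % n) hxy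
    simp only [ancestorKey, Nat.mul_add_mod_self_right, Nat.mod_eq_of_lt (hn _)] at this
    exact hidx this

/-- The key is a base `n` numeral whose digits are the ancestors, oldest first; going up `t`
generations drops the last `t` digits. Hence taking ancestors is monotone in the key. -/
lemma ancestorKey_iterate {π : V → V} {idx : V → ℕ} {n : ℕ} (hn : ∀ x, idx x < n) (j t : ℕ)
    (x : V) : ancestorKey π idx n j (π^[t] x) = ancestorKey π idx n (j + t) x / n ^ t := by
  induction t generalizing x with
  | zero => simp
  | succ t ih =>
    have hpos : 0 < n := (Nat.zero_le _).trans_lt (hn x)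
    rw [Function.iterate_succ_apply, ih, pow_succ', ← Nat.div_div_eq_div_mul, ← add_assoc]
    congr 1
    simp only [ancestorKey]
    rw [mul_comm, Nat.mul_add_div hpos, Nat.div_eq_of_lt (hn x), add_zero]

/-- A vertex set with more than `M * α(G)` vertices contains a path with `M` edges along which a
given numbering increases. -/
lemma exists_increasing_path [Finite V] {key : V → ℕ} (hkey : Function.Injective key) (M : ℕ)
    (S : Finset V) (hS : M * G.indepNum < S.card) :
    ∃ x : ℕ → V, (∀ a ≤ M, x a ∈ S) ∧ (∀ a < M, G.Adj (x a) (x (a + 1))) ∧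
      ∀ a < M, key (x a) < key (x (a + 1)) := by
  classical
  induction M generalizing S with
  | zero =>
    obtain ⟨s, hs⟩ := Finset.card_pos.1 ((Nat.zero_le _).trans_lt hS)
    exact ⟨fun _ => s, fun _ _ => hs, by simp, by simp⟩
  | succ M ih =>
    -- The vertices outside `T` have no smaller neighbour in `S`, so they are independent and
    -- removing them costs at most `α`. A path in `T` can be prolonged at its start.
    set T := S.filter fun z => ∃ y ∈ S, G.Adj y z ∧ key y < key z with hT
    have hind : G.IsIndepSet (S \ T : Finset V) := by
      intro a ha b hb hab hadj
      simp only [hT, Finset.coe_sdiff, Finset.coe_filter, Set.mem_sdiff, Finset.mem_coe,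
        Set.mem_ofPred_eq, not_and, not_exists, not_lt] at ha hb
      exact hab (hkey (le_antisymm (ha.2 ha.1 b hb.1 hadj.symm) (hb.2 hb.1 a ha.1 hadj)))
    have h1 : (S \ T).card ≤ G.indepNum := hind.card_le_indepNum
    have h2 : (S \ T).card + T.card = S.card :=
      Finset.card_sdiff_add_card_eq_card (Finset.filter_subset _ _)
    have h3 : M * G.indepNum < T.card := by
      rw [add_mul, one_mul] at hS
      omega
    obtain ⟨x, hxS, hadj, hlt⟩ := ih T h3
    obtain ⟨-, y, hyS, hy, hyk⟩ := Finset.mem_filter.1 (hxS 0 (Nat.zero_le _))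
    refine ⟨fun a => Nat.casesOn a y x, ?_, ?_, ?_⟩
    · rintro (_ | a) ha
      · exact hyS
      · exact (Finset.mem_filter.1 (hxS a (by omega))).1
    · rintro (_ | a) ha
      · exact hy
      · exact hadj a (by omega)
    · rintro (_ | a) ha
      · exact hyk
      · exact hlt a (by omega)

/-- A level with more than `M * α(G)` vertices yields cycles of all short lengths. -/
lemma exists_isCycle_of_card_level [Fintype V] {v : V} {i M l : ℕ} {S : Finset V}
    (hS : ∀ x ∈ S, G.edist v x = i) (hcard : M * G.indepNum < S.card)
    (hil : 2 * i + 1 ≤ l) (hlM : l ≤ M + 2) (hM : 1 ≤ M) :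
    ∃ (u : V) (c : G.Walk u u), c.IsCycle ∧ c.length = l := by
  obtain ⟨π, hπ⟩ := G.exists_isParentMap v
  set n := Fintype.card V
  set idx : V → ℕ := fun x => Fintype.equivFin V x with hidx
  have hinj : Function.Injective idx := fun a b hab => by
    simpa [hidx, Fin.val_inj] using hab
  have hn : ∀ x, idx x < n := fun x => (Fintype.equivFin V x).2
  obtain ⟨x, hxS, hadj, hlt⟩ :=
    exists_increasing_path (G := G) (ancestorKey_injective (π := π) hinj hn i) M S hcard
  have hlt' : ∀ b, ∀ a < b, b ≤ M →
      ancestorKey π idx n i (x a) < ancestorKey π idx n i (x b) := by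
    intro b
    induction b with
    | zero => intro a ha; omega
    | succ b ih =>
      intro a ha hb
      rcases Nat.lt_succ_iff_lt_or_eq.1 ha with h | rfl
      · exact (ih a h (by omega)).trans (hlt b (by omega))
      · exact hlt a (by omega)
  have hxinj : ∀ a ≤ M, ∀ b ≤ M, x a = x b → a = b := by
    intro a ha b hb hab
    rcases lt_trichotomy a b with h | h | h
    · exact absurd (hlt' b a h hb) (by simp [hab])
    · exact h
    · exact absurd (hlt' a b h ha) (by simp [hab])
  obtain ⟨h, hhi, heq, hne⟩ := hπ.exists_height (hS _ (hxS 0 (Nat.zero_le _)))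
    (hS _ (hxS M le_rfl)) (fun e => by have := hxinj 0 (by omega) M le_rfl e; omega)
  have hmono : ∀ t ≤ i, ∀ a b, a ≤ b → b ≤ M →
      ancestorKey π idx n (i - t) (π^[t] (x a)) ≤ ancestorKey π idx n (i - t) (π^[t] (x b)) := by
    intro t ht a b hab hb
    rw [ancestorKey_iterate hn, ancestorKey_iterate hn, Nat.sub_add_cancel ht]
    refine Nat.div_le_div_right ?_
    rcases hab.lt_or_eq with h | rfl
    · exact (hlt' b a h hb).le
    · exact le_rfl
  have hsqueeze : ∀ t ≤ i, ∀ a b c d, a ≤ b → b ≤ c → c ≤ d → d ≤ M →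
      π^[t] (x a) = π^[t] (x d) → π^[t] (x b) = π^[t] (x c) := by
    intro t ht a b c d hab hbc hcd hd e
    refine ancestorKey_injective hinj hn (i - t) (le_antisymm (hmono t ht b c hbc (by omega)) ?_)
    calc _ ≤ _ := hmono t ht c d hcd hd
      _ = _ := by rw [e]
      _ ≤ _ := hmono t ht a b hab (by omega)
  -- By monotonicity, every window of the path containing this jump has ends that merge after
  -- exactly `h + 1` steps, so its length can be chosen freely.
  obtain ⟨t, htM, ht⟩ : ∃ t < M, π^[h] (x t) ≠ π^[h] (x (t + 1)) := by
    by_contra! hcon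
    have : ∀ b ≤ M, π^[h] (x 0) = π^[h] (x b) := by
      intro b
      induction b with
      | zero => simp
      | succ b ih => exact fun hb => (ih (by omega)).trans (hcon b (by omega))
    exact hne (this M le_rfl)
  obtain ⟨L, rfl⟩ : ∃ L, l = L + 2 * (h + 1) := ⟨l - 2 * (h + 1), by omega⟩
  obtain ⟨a, hat, hta, haM⟩ : ∃ a ≤ t, t + 1 ≤ a + L ∧ a + L ≤ M := by
    rcases le_total t (M - L) with h' | h'
    · exact ⟨t, le_rfl, by omega, by omega⟩
    · exact ⟨M - L, h', by omega, by omega⟩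
  obtain ⟨p, hp, hpl, hps⟩ := exists_isPath_of_injOn hadj hxinj a L haM
  obtain ⟨u, c, hc, hcl⟩ := hπ.exists_isCycle h hhi (hS _ (hxS a (by omega)))
    (hS _ (hxS (a + L) haM))
    (hsqueeze (h + 1) hhi 0 a (a + L) M (by omega) (by omega) haM le_rfl heq)
    (fun e => ht (hsqueeze h (by omega) a t (t + 1) (a + L) hat (by omega) hta haM e)) p hp
    (fun z hz => by
      obtain ⟨k, -, hk, rfl⟩ := hps z hz
      exact (hS _ (hxS k (by omega))).ge)
  exact ⟨u, c, hc, by omega⟩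

/-! ### Dense pairs and paths of flexible length -/

open scoped Classical in
/-- A pair of vertex sets with many edges between them contains a pair of large minimum degree. -/
lemma exists_minDegree_pair (m : ℕ) (A B : Finset V)
    (h : m * (A.card + B.card) < ∑ x ∈ A, (B.filter (G.Adj x)).card) :
    ∃ X ⊆ A, ∃ Y ⊆ B, X.Nonempty ∧ (∀ x ∈ X, m < (Y.filter (G.Adj x)).card) ∧
      ∀ y ∈ Y, m < (X.filter (G.Adj y)).card := by
  induction hk : A.card + B.card generalizing A B with
  | zero =>
    obtain ⟨rfl, rfl⟩ : A = ∅ ∧ B = ∅ := by simpa using hk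
    simp at h
  | succ k ih =>
    -- Deleting a vertex of degree at most `m` lowers both sides of `h` without breaking it: the
    -- left by `m`, the right by at most `m`.
    by_cases hA : ∃ x ∈ A, (B.filter (G.Adj x)).card ≤ m
    · obtain ⟨x, hx, hxm⟩ := hA
      have hc := Finset.card_erase_add_one hx
      have hs := Finset.add_sum_erase A (fun x => (B.filter (G.Adj x)).card) hx
      obtain ⟨X, hX, Y, hY, hXY⟩ := ih (A.erase x) B (by
        have : A.card + B.card = (A.erase x).card + B.card + 1 := by omega
        rw [this, mul_add, mul_one] at h
        omega) (by omega)
      exact ⟨X, hX.trans (Finset.erase_subset _ _), Y, hY, hXY⟩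
    by_cases hB : ∃ y ∈ B, (A.filter (G.Adj y)).card ≤ m
    · obtain ⟨y, hy, hym⟩ := hB
      have hc := Finset.card_erase_add_one hy
      have hswap : ∀ B : Finset V, ∑ x ∈ A, (B.filter (G.Adj x)).card =
          ∑ y ∈ B, (A.filter (G.Adj y)).card := by
        intro B
        simp only [Finset.card_filter]
        rw [Finset.sum_comm]
        simp only [G.adj_comm]
      have hs := Finset.add_sum_erase B (fun y => (A.filter (G.Adj y)).card) hy
      obtain ⟨X, hX, Y, hY, hXY⟩ := ih A (B.erase y) (by
        have : A.card + B.card = A.card + (B.erase y).card + 1 := by omega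
        rw [this, mul_add, mul_one, hswap] at h
        rw [hswap]
        omega) (by omega)
      exact ⟨X, hX, Y, hY.trans (Finset.erase_subset _ _), hXY⟩
    push Not at hA hB
    refine ⟨A, subset_rfl, B, subset_rfl, ?_, hA, hB⟩
    by_contra hne
    rw [Finset.not_nonempty_iff_eq_empty] at hne
    simp [hne] at h

open scoped Classical in
/-- A chain of `s` triangles through a pair of large minimum degree provides paths of all lengths
between `2 * s` and `3 * s` with the same ends. -/
lemma exists_flexible_paths [Fintype V] {X Y : Finset V} {m : ℕ} (hX : X.Nonempty)
    (hXY : ∀ x ∈ X, m < (Y.filter (G.Adj x)).card)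
    (hYX : ∀ y ∈ Y, m < (X.filter (G.Adj y)).card) (s : ℕ) (hs : 3 * s + G.indepNum ≤ m) :
    ∃ F ⊆ X ∪ Y, F.card ≤ 3 * s + 1 ∧ ∃ x ∈ X, ∃ y ∈ X, ∀ l, 2 * s ≤ l → l ≤ 3 * s →
      ∃ p : G.Walk x y, p.IsPath ∧ p.length = l ∧ ∀ z ∈ p.support, z ∈ F := by
  induction s with
  | zero =>
    obtain ⟨x, hx⟩ := hX
    refine ⟨{x}, by simp [hx], by simp, x, hx, x, hx,
      fun l _ hl => ⟨Walk.nil, by simp, ?_, by simp⟩⟩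
    simp only [Walk.length_nil]
    omega
  | succ s ih =>
    obtain ⟨F, hF, hFc, x, hx, y, hy, hp⟩ := ih (by omega)
    have h1 : G.indepNum < (Y.filter (G.Adj x) \ F).card := by
      have := Finset.le_card_sdiff F (Y.filter (G.Adj x))
      have := hXY x hx
      omega
    -- In the triangle `x a b`, the passage from `x` to `a` takes one edge, or two via `b`; the edge
    -- `a w` returns to `X`.
    obtain ⟨a, ha, b, hb, hab⟩ : ∃ a ∈ Y.filter (G.Adj x) \ F, ∃ b ∈ Y.filter (G.Adj x) \ F,
        G.Adj a b := by
      by_contra! hcon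
      refine h1.not_ge (IsIndepSet.card_le_indepNum fun a ha b hb _ => hcon a ha b hb)
    simp only [Finset.mem_sdiff, Finset.mem_filter] at ha hb
    obtain ⟨w, hw⟩ : (X.filter (G.Adj a) \ insert b F).Nonempty := by
      have := Finset.le_card_sdiff (insert b F) (X.filter (G.Adj a))
      have := Finset.card_insert_le b F
      have := hYX a ha.1.1
      exact Finset.card_pos.1 (by omega)
    simp only [Finset.mem_sdiff, Finset.mem_filter, Finset.mem_insert, not_or] at hw
    obtain ⟨⟨hwX, haw⟩, hwb, hwF⟩ := hw
    refine ⟨insert w (insert a (insert b F)), ?_, ?_, w, hwX, y, hy, fun l hl1 hl2 => ?_⟩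
    · simp only [Finset.insert_subset_iff, Finset.mem_union]
      exact ⟨Or.inl hwX, Or.inr ha.1.1, Or.inr hb.1.1, hF⟩
    · have := Finset.card_insert_le w (insert a (insert b F))
      have := Finset.card_insert_le a (insert b F)
      have := Finset.card_insert_le b F
      omega
    · have hwa := haw.ne'
      by_cases hl : l ≤ 3 * s + 2
      · obtain ⟨p, hpp, hpl, hps⟩ := hp (l - 2) (by omega) (by omega)
        have i1 : a ∉ p.support := fun h => ha.2 (hps _ h)
        have i2 : w ∉ p.support := fun h => hwF (hps _ h)
        refine ⟨Walk.cons haw.symm (Walk.cons ha.1.2.symm p), ?_, ?_, ?_⟩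
        · simp [Walk.cons_isPath_iff, hpp, i1, i2, hwa]
        · simp only [Walk.length_cons]
          omega
        · intro z hz
          simp only [Walk.support_cons, List.mem_cons] at hz
          simp only [Finset.mem_insert]
          rcases hz with h | h | h
          · exact Or.inl h
          · exact Or.inr (Or.inl h)
          · exact Or.inr (Or.inr (Or.inr (hps _ h)))
      · obtain ⟨p, hpp, hpl, hps⟩ := hp (l - 3) (by omega) (by omega)
        have i1 : a ∉ p.support := fun h => ha.2 (hps _ h)
        have i2 : w ∉ p.support := fun h => hwF (hps _ h)
        have i3 : b ∉ p.support := fun h => hb.2 (hps _ h)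
        refine ⟨Walk.cons haw.symm (Walk.cons hab (Walk.cons hb.1.2.symm p)), ?_, ?_, ?_⟩
        · simp [Walk.cons_isPath_iff, hpp, i1, i2, i3, hwa, hwb, hab.ne]
        · simp only [Walk.length_cons]
          omega
        · intro z hz
          simp only [Walk.support_cons, List.mem_cons] at hz
          simp only [Finset.mem_insert]
          rcases hz with h | h | h | h
          · exact Or.inl h
          · exact Or.inr (Or.inl h)
          · exact Or.inr (Or.inr (Or.inl h))
          · exact Or.inr (Or.inr (Or.inr (hps _ h)))

open scoped Classical in
/-- Many edges between a level `i` and a set in levels `≥ i` give cycles of medium length. -/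
lemma exists_isCycle_of_dense_levels [Fintype V] {v : V} {i m l : ℕ} {A B : Finset V}
    (hA : ∀ x ∈ A, G.edist v x = i) (hB : ∀ x ∈ B, (i : ℕ∞) ≤ G.edist v x)
    (h : m * (A.card + B.card) < ∑ x ∈ A, (B.filter (G.Adj x)).card)
    (hl : 3 ≤ l) (hil : 6 * i ≤ l) (hm : l + G.indepNum ≤ m) :
    ∃ (u : V) (c : G.Walk u u), c.IsCycle ∧ c.length = l := by
  obtain ⟨π, hπ⟩ := G.exists_isParentMap v
  obtain ⟨X, hX, Y, hY, hne, hXY, hYX⟩ := exists_minDegree_pair m A B h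
  obtain ⟨F, hF, -, x, hx, y, hy, hp⟩ :=
    exists_flexible_paths hne hXY hYX (l / 3) (by omega)
  have hxy : x ≠ y := by
    rintro rfl
    obtain ⟨p, hpp, hpl, -⟩ := hp (2 * (l / 3)) le_rfl (by omega)
    rw [Walk.isPath_iff_nil, ← Walk.length_eq_zero_iff] at hpp
    omega
  obtain ⟨t, hti, heq, hne⟩ := hπ.exists_height (hA x (hX hx)) (hA y (hX hy)) hxy
  -- This length is available because `2 ≤ 2 * (t + 1) ≤ 2 * i ≤ l / 3`.
  obtain ⟨p, hpp, hpl, hps⟩ := hp (l - 2 * (t + 1)) (by omega) (by omega)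
  obtain ⟨u, c, hc, hcl⟩ := hπ.exists_isCycle t hti (hA x (hX hx)) (hA y (hX hy)) heq hne p hpp
    (fun z hz => by
      rcases Finset.mem_union.1 (hF (hps z hz)) with h | h
      · exact (hA z (hX h)).ge
      · exact hB z (hY h))
  exact ⟨u, c, hc, by omega⟩

/-! ### Growth of levels -/

open scoped Classical in
/-- The vertices at distance `i` from `v`. -/
noncomputable def level [Fintype V] (G : SimpleGraph V) (v : V) (i : ℕ) : Finset V :=
  Finset.univ.filter fun x => G.edist v x = i

lemma mem_level [Fintype V] {v x : V} {i : ℕ} : x ∈ G.level v i ↔ G.edist v x = i := by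
  simp [level]

lemma level_zero [Fintype V] {v : V} : G.level v 0 = {v} := by
  ext x
  rw [mem_level, Nat.cast_zero, edist_eq_zero_iff, Finset.mem_singleton, eq_comm]

lemma card_level_one [Fintype V] [DecidableRel G.Adj] {v : V} :
    (G.level v 1).card = G.degree v := by
  rw [← card_neighborFinset_eq_degree]
  congr 1
  ext x
  simp [mem_level]

lemma mem_level_of_adj [Fintype V] {v x y : V} {i : ℕ} (hx : x ∈ G.level v (i + 1))
    (h : G.Adj x y) : y ∈ G.level v i ∨ y ∈ G.level v (i + 1) ∨ y ∈ G.level v (i + 2) := by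
  simp only [mem_level] at *
  have h1 : G.edist v y ≤ G.edist v x + G.edist x y := SimpleGraph.edist_triangle
  have h2 : G.edist v x ≤ G.edist v y + G.edist y x := SimpleGraph.edist_triangle
  rw [edist_eq_one_iff_adj.2 h, hx] at h1
  rw [edist_eq_one_iff_adj.2 h.symm, hx] at h2
  obtain ⟨k, hk⟩ : ∃ k : ℕ, G.edist v y = k :=
    ⟨_, (ENat.natCast_toNat (ne_top_of_le_ne_top (by simp) h1)).symm⟩
  rw [hk] at h1 h2 ⊢
  norm_cast at h1 h2 ⊢
  omega

open scoped Classical in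
-- Downward edges are counted from level `i`, since `exists_isCycle_of_dense_levels` wants the lower
-- level as its first set.
lemma sum_degree_level_le [Fintype V] {v : V} (i : ℕ) :
    ∑ x ∈ G.level v (i + 1), G.degree x ≤
      ∑ x ∈ G.level v i, ((G.level v (i + 1)).filter (G.Adj x)).card +
      ∑ x ∈ G.level v (i + 1), ((G.level v (i + 1)).filter (G.Adj x)).card +
      ∑ x ∈ G.level v (i + 1), ((G.level v (i + 2)).filter (G.Adj x)).card := by
  have hswap : ∑ x ∈ G.level v i, ((G.level v (i + 1)).filter (G.Adj x)).card =
      ∑ x ∈ G.level v (i + 1), ((G.level v i).filter (G.Adj x)).card := by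
    simp only [Finset.card_filter]
    rw [Finset.sum_comm]
    simp only [G.adj_comm]
  rw [hswap, ← Finset.sum_add_distrib, ← Finset.sum_add_distrib]
  refine Finset.sum_le_sum fun x hx => ?_
  rw [← card_neighborFinset_eq_degree]
  refine (Finset.card_le_card (t := (G.level v i).filter (G.Adj x) ∪
    (G.level v (i + 1)).filter (G.Adj x) ∪ (G.level v (i + 2)).filter (G.Adj x)) ?_).trans ?_
  · intro y hy
    rw [mem_neighborFinset] at hy
    simp only [Finset.mem_union, Finset.mem_filter, hy, and_true, or_assoc]
    exact mem_level_of_adj hx hy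
  · exact (Finset.card_union_le _ _).trans (Nat.add_le_add_right (Finset.card_union_le _ _) _)

/-- Around a level that is at least twice as large as the previous one and at least half as large
as the next one, there are cycles of medium length. -/
lemma exists_isCycle_of_slow_growth [Fintype V] [DecidableRel G.Adj] {v : V} {i l : ℕ}
    (hprev : 2 * (G.level v i).card ≤ (G.level v (i + 1)).card)
    (hnext : (G.level v (i + 2)).card ≤ 2 * (G.level v (i + 1)).card)
    (hpos : 0 < (G.level v (i + 1)).card) (hl : 3 ≤ l) (hil : 6 * (i + 1) ≤ l)
    (hm : 7 * (l + G.indepNum) ≤ G.minDegree) :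
    ∃ (u : V) (c : G.Walk u u), c.IsCycle ∧ c.length = l := by
  classical
  by_contra hno
  set m := l + G.indepNum with hm'
  have hlow : ∀ x ∈ G.level v (i + 1), ((i + 1 : ℕ) : ℕ∞) ≤ G.edist v x :=
    fun x hx => (mem_level.1 hx).ge
  have d1 : ¬ m * ((G.level v i).card + (G.level v (i + 1)).card) < _ := fun h =>
    hno (exists_isCycle_of_dense_levels (fun x hx => mem_level.1 hx)
      (fun x hx => le_trans (by exact_mod_cast Nat.le_succ i) (hlow x hx)) h hl (by omega) le_rfl)
  have d2 : ¬ m * ((G.level v (i + 1)).card + (G.level v (i + 1)).card) < _ := fun h =>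
    hno (exists_isCycle_of_dense_levels (fun x hx => mem_level.1 hx) hlow h hl (by omega) le_rfl)
  have d3 : ¬ m * ((G.level v (i + 1)).card + (G.level v (i + 2)).card) < _ := fun h =>
    hno (exists_isCycle_of_dense_levels (fun x hx => mem_level.1 hx)
      (fun x hx => (mem_level.1 hx).ge.trans' (by exact_mod_cast Nat.le_succ (i + 1)))
      h hl (by omega) le_rfl)
  rw [not_lt] at d1 d2 d3
  have hmpos : 0 < m := by omega
  refine absurd (le_trans (?_ : (G.level v (i + 1)).card * (7 * m) ≤ _)
    (G.sum_degree_level_le (v := v) i)) (not_le.2 ?_)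
  · rw [← smul_eq_mul]
    refine Finset.card_nsmul_le_sum _ _ _ fun x _ =>
      (hm.trans (G.minDegree_le_degree x)).trans_eq ?_
    congr!
  · refine (Nat.add_le_add (Nat.add_le_add d1 d2) d3).trans_lt ?_
    -- In units of `m` times the size of level `i + 1`, the three bounds are 3/2, 2 and 3, in total
    -- less than 7.
    nlinarith [Nat.mul_le_mul_left m hprev, Nat.mul_le_mul_left m hnext, Nat.mul_pos hmpos hpos]

/-- If large levels are excluded, some early level grows slowly. -/
lemma exists_slow_growth {f : ℕ → ℕ} {a l : ℕ} (ha : 0 < a) (h1 : 300 * a ≤ f 1)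
    (h0 : 2 * f 0 ≤ f 1) (hf : ∀ i, 1 ≤ i → 2 * i + 1 ≤ l → f i ≤ (l - 2) * a) (hl : 3 ≤ l) :
    ∃ i, 6 * (i + 1) ≤ l ∧ 2 * f i ≤ f (i + 1) ∧ f (i + 2) ≤ 2 * f (i + 1) ∧ 0 < f (i + 1) := by
  classical
  have hl' : 302 ≤ l := by
    have := h1.trans (hf 1 le_rfl (by omega))
    have := Nat.le_of_mul_le_mul_right this ha
    omega
  -- This linear consequence of doubling is enough: at level `l / 6` it already exceeds `(l - 2) *
  -- a`.
  have hgrow : ∀ i, (∀ j < i, 2 * f (j + 1) < f (j + 2)) → 300 * (i + 1) * a ≤ f (i + 1) := by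
    intro i
    induction i with
    | zero => intro _; simpa using h1
    | succ i ih =>
      intro hj
      have h2 := ih fun j hji => hj j (by omega)
      have h3 := hj i (by omega)
      nlinarith
  have hex : ∃ j, f (j + 2) ≤ 2 * f (j + 1) ∧ 6 * (j + 1) ≤ l := by
    by_contra! hcon
    have h2 := hgrow (l / 6 - 1) fun j hj => by
      by_contra! h
      have := hcon j h
      omega
    have h3 := Nat.le_of_mul_le_mul_right (h2.trans (hf _ (by omega) (by omega))) ha
    omega
  obtain ⟨hs, hsl⟩ := Nat.find_spec hex
  have hmin : ∀ j < Nat.find hex, 2 * f (j + 1) < f (j + 2) := by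
    intro j hj
    by_contra! h
    exact Nat.find_min hex hj ⟨h, by omega⟩
  refine ⟨Nat.find hex, hsl, ?_, hs, ?_⟩
  · rcases hk : Nat.find hex with _ | k
    · simpa using h0
    · exact (hmin k (by omega)).le
  · have := hgrow _ hmin
    have : 0 < 300 * (Nat.find hex + 1) * a := by positivity
    omega

end SimpleGraph

/-! ### The main theorem -/

theorem theorem1p3 {V : Type*} [Fintype V] (G : SimpleGraph V) [DecidableRel G.Adj]
    (hG : 300 * G.indepNum ≤ G.minDegree) :
    ∀ ℓ : ℕ, 3 ≤ ℓ → (ℓ : ℝ) ≤ (G.minDegree : ℝ) / 81 →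
      ∃ (v : V) (c : G.Walk v v), c.IsCycle ∧ c.length = ℓ := by
  intro l hl hld
  have hld' : 81 * l ≤ G.minDegree := by
    rw [le_div_iff₀ (by norm_num)] at hld
    have : l * 81 ≤ G.minDegree := by exact_mod_cast hld
    omega
  rcases isEmpty_or_nonempty V with hV | ⟨⟨v⟩⟩
  · have : G.minDegree = 0 := G.minDegree_of_subsingleton
    omega
  have ha : 0 < G.indepNum := by
    have : G.IsIndepSet ({v} : Finset V) := by simp [SimpleGraph.IsIndepSet]
    simpa [Nat.one_le_iff_ne_zero, Nat.pos_iff_ne_zero] using this.card_le_indepNum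
  by_contra hno
  have hf : ∀ i, 1 ≤ i → 2 * i + 1 ≤ l → (G.level v i).card ≤ (l - 2) * G.indepNum := by
    intro i _ hil
    by_contra! hlt
    exact hno (SimpleGraph.exists_isCycle_of_card_level
      (fun x hx => SimpleGraph.mem_level.1 hx) hlt hil (by omega) (by omega))
  have hdeg := G.minDegree_le_degree v
  obtain ⟨i, hil, hprev, hnext, hpos⟩ :=
    SimpleGraph.exists_slow_growth (f := fun i => (G.level v i).card) ha
      (by simp only [SimpleGraph.card_level_one]; omega)
      (by simp only [SimpleGraph.card_level_one, SimpleGraph.level_zero, Finset.card_singleton]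
          omega) hf hl
  exact hno (SimpleGraph.exists_isCycle_of_slow_growth hprev hnext hpos hl hil (by omega))
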